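/- **Theorem 3.2.** Let $A\in\mathbb C^{m\times m}$ be Hermitian and $B\in\mathbb C^{m\times n}$. Write $r(\cdot)$ for the rank, $\mathscr R(\cdot)$ for the range, $C^{\dagger}$ for the Moore–Penrose inverse, $F_C=I-C^{\dagger}C$, and $i_+(C)$, $i_-(C)$ for the numbers of positive and negative eigenvalues (counted with multiplicity) of a Hermitian matrix $C$. For matrices $Z,A$ of the same size, $Z\leqslant^{-}A$ means $r(A-Z)=r(A)-r(Z)$. Put $$M=\begin{bmatrix}A&B\\B^*&0\end{bmatrix},\quad H=[\,B,\,-A\,],\quad \widehat I_n=[\,I_n,\,0\,]\in\mathbb C^{n\times(n+m)},\quad \widehat B=[\,B,\,0\,]\in\mathbb C^{m\times(n+m)},$$ $$\mathcal S_1=\{\,Z\in\mathbb C^{m\times m}\;:\;Z=Z^*,\ Z\leqslant^{-}A,\ \mathscr R(Z)\subseteq\mathscr R(B)\,\}.$$ (a) A matrix $X\in\mathbb C^{n\times n}$ is Hermitian and satisfies $BXB^*\leqslant^{-}A$ if and only if $$X=\widehat I_nF_HU\bigl(U^*F_H\widehat B^*A^{\dagger}\widehat BF_HU\bigr)^{\dagger}U^*F_H\widehat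 I_n^*+V-B^{\dagger}BVB^{\dagger}B$$ for some $U\in\mathbb C^{(m+n)\times(m+n)}$ and some Hermitian $V\in\mathbb C^{n\times n}$. (b) A matrix $Z\in\mathbb C^{m\times m}$ belongs to $\mathcal S_1$ if and only if $$Z=\widehat BF_HU\bigl(U^*F_H\widehat B^*A^{\dagger}\widehat BF_HU\bigr)^{\dagger}U^*F_H\widehat B^*$$ for some $U\in\mathbb C^{(m+n)\times(m+n)}$. Moreover (with the upper signs, and with the lower signs), $$\max_{Z\in\mathcal S_1}i_\pm(Z)=i_\mp(M)+i_\pm(A)-r[\,A,\,B\,],\qquad \max_{Z\in\mathcal S_1}r(Z)=r(M)+r(A)-2r[\,A,\,B\,],$$ $$\min_{Z\in\mathcal S_1}i_\pm(A-Z)=r[\,A,\,B\,]-i_\mp(M),\qquad \min_{Z\in\mathcal S_1}r(A-Z)=2r[\,A,\,B\,]-r(M).$$ Finally, the matrix $$\phi^{-}(A\,|\,B)=\widehat BF_H\bigl(F_H\widehat B^*A^{\dagger}\widehat BF_H\bigr)^{\dagger}F_H\widehat B^*$$ is a shorted matrix of $A$ relative to $\mathscr R(B)$ in the minus partial ordering,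 that is, it belongs to $\mathcal S_1$ and has the maximal possible rank among the elements of $\mathcal S_1$. -/

import Mathlib

open scoped Matrix

/-- The four Penrose equations: `X` is a Moore–Penrose inverse of `A`. -/
structure IsMoorePenrose {m n : Type*} [Fintype m] [Fintype n]
    (A : Matrix m n ℂ) (X : Matrix n m ℂ) : Prop where
  mul_mul_self : A * X * A = A
  self_mul_mul : X * A * X = X
  isHermitian_left : (A * X).IsHermitian
  isHermitian_right : (X * A).IsHermitian

theorem IsMoorePenrose.unique {m n : Type*} [Fintype m] [Fintype n]
    {A : Matrix m n ℂ} {X Y : Matrix n m ℂ}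
    (hX : IsMoorePenrose A X) (hY : IsMoorePenrose A Y) : X = Y := by
  have e1 : A * X = A * Y := by
    have h : (A * X) * (A * Y) = A * Y := by
      rw [← Matrix.mul_assoc, hX.mul_mul_self]
    have h2 : (A * Y) * (A * X) = A * X := by
      rw [← Matrix.mul_assoc, hY.mul_mul_self]
    have h3 := congrArg Matrix.conjTranspose h
    rw [Matrix.conjTranspose_mul, hX.isHermitian_left.eq, hY.isHermitian_left.eq] at h3
    exact h2.symm.trans h3
  have e2 : X * A = Y * A := by
    have h : (X * A) * (Y * A) = X * A := by
      rw [Matrix.mul_assoc, ← Matrix.mul_assoc A, hY.mul_mul_self]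
    have h2 : (Y * A) * (X * A) = Y * A := by
      rw [Matrix.mul_assoc, ← Matrix.mul_assoc A, hX.mul_mul_self]
    have h3 := congrArg Matrix.conjTranspose h
    rw [Matrix.conjTranspose_mul, hX.isHermitian_right.eq, hY.isHermitian_right.eq] at h3
    exact h3.symm.trans h2
  rw [← hX.self_mul_mul, e2, Matrix.mul_assoc, e1, ← Matrix.mul_assoc, hY.self_mul_mul]

theorem exists_isMoorePenrose_of_isHermitian {n : Type*} [Fintype n] [DecidableEq n]
    {A : Matrix n n ℂ} (hA : A.IsHermitian) :
    ∃ X : Matrix n n ℂ, X.IsHermitian ∧ IsMoorePenrose A X := by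
  set U : Matrix n n ℂ := (hA.eigenvectorUnitary : Matrix n n ℂ) with hU
  have hUU : Uᴴ * U = 1 := Unitary.coe_star_mul_self hA.eigenvectorUnitary
  set d : n → ℂ := fun i => (hA.eigenvalues i : ℂ) with hd
  have key : ∀ P Q : n → ℂ, (U * Matrix.diagonal P * Uᴴ) * (U * Matrix.diagonal Q * Uᴴ)
      = U * Matrix.diagonal (fun i => P i * Q i) * Uᴴ := by
    intro P Q
    calc _ = U * Matrix.diagonal P * (Uᴴ * U) * Matrix.diagonal Q * Uᴴ := by
          simp only [Matrix.mul_assoc]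
      _ = _ := by
          rw [hUU, Matrix.mul_one, Matrix.mul_assoc U, Matrix.diagonal_mul_diagonal]
  have herm : ∀ P : n → ℝ,
      (U * Matrix.diagonal (fun i => (P i : ℂ)) * Uᴴ).IsHermitian := by
    intro P
    apply Matrix.isHermitian_mul_mul_conjTranspose
    rw [Matrix.isHermitian_diagonal_iff]
    intro i
    simp [isSelfAdjoint_iff]
  have hspec : A = U * Matrix.diagonal d * Uᴴ := by
    have := hA.spectral_theorem
    rw [Unitary.conjStarAlgAut_apply] at this
    exact this
  have hinv : (fun i => (d i)⁻¹) = fun i => (((hA.eigenvalues i)⁻¹ : ℝ) : ℂ) := by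
    funext i; simp [hd]
  have hone : (fun i => d i * (d i)⁻¹)
      = fun i => ((hA.eigenvalues i * (hA.eigenvalues i)⁻¹ : ℝ) : ℂ) := by
    funext i; simp [hd]
  have hone' : (fun i => (d i)⁻¹ * d i)
      = fun i => ((hA.eigenvalues i * (hA.eigenvalues i)⁻¹ : ℝ) : ℂ) := by
    funext i; simp [hd, mul_comm]
  refine ⟨U * Matrix.diagonal (fun i => (d i)⁻¹) * Uᴴ, ?_, ?_, ?_, ?_, ?_⟩
  · rw [hinv]; exact herm _
  · rw [hspec, key, key]; congr 3; funext i; exact mul_inv_mul_cancel _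
  · rw [hspec, key, key]; congr 3; funext i
    by_cases h : d i = 0 <;> simp [h]
  · rw [hspec, key, hone]; exact herm _
  · rw [hspec, key, hone']; exact herm _

open scoped ComplexOrder in
theorem exists_isMoorePenrose {m n : Type*} [Fintype m] [Fintype n]
    (A : Matrix m n ℂ) : ∃ X : Matrix n m ℂ, IsMoorePenrose A X := by
  classical
  obtain ⟨G, hG, h⟩ :=
    exists_isMoorePenrose_of_isHermitian (Matrix.isHermitian_conjTranspose_mul_self A)
  have hz : A * (G * (Aᴴ * A)) - A = 0 := by
    rw [← Matrix.conjTranspose_mul_self_eq_zero]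
    have h1 : Aᴴ * (A * (G * (Aᴴ * A)) - A) = 0 := by
      have := h.mul_mul_self
      rw [Matrix.mul_sub, sub_eq_zero]
      simpa only [Matrix.mul_assoc] using this
    have h2 : (A * (G * (Aᴴ * A)) - A)ᴴ = ((G * (Aᴴ * A))ᴴ - 1) * Aᴴ := by
      rw [Matrix.conjTranspose_sub, Matrix.conjTranspose_mul A, Matrix.sub_mul, Matrix.one_mul]
    rw [h2, Matrix.mul_assoc, h1, Matrix.mul_zero]
  refine ⟨G * Aᴴ, ?_, ?_, ?_, ?_⟩
  · have := sub_eq_zero.mp hz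
    simpa only [Matrix.mul_assoc] using this
  · have := congrArg (· * Aᴴ) h.self_mul_mul
    simpa only [Matrix.mul_assoc] using this
  · rw [← Matrix.mul_assoc]
    exact Matrix.isHermitian_mul_mul_conjTranspose A hG
  · rw [Matrix.mul_assoc]; exact h.isHermitian_right

/-- The Moore–Penrose inverse `A†`: the unique solution of the Penrose equations. -/
noncomputable def pinv {m n : Type*} [Fintype m] [Fintype n]
    (A : Matrix m n ℂ) : Matrix n m ℂ :=
  Classical.choose (exists_isMoorePenrose A)

theorem isMoorePenrose_pinv {m n : Type*} [Fintype m] [Fintype n]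
    (A : Matrix m n ℂ) : IsMoorePenrose A (pinv A) :=
  Classical.choose_spec (exists_isMoorePenrose A)

/-- The orthogonal projector `F_A = I - A†A`. -/
noncomputable def projF {m n : Type*} [Fintype m] [Fintype n] [DecidableEq n]
    (A : Matrix m n ℂ) : Matrix n n ℂ :=
  1 - pinv A * A

/-- `i₊(A)`: the number of positive eigenvalues, with multiplicity, of a Hermitian matrix. -/
noncomputable def inertiaPos {n : Type*} [Fintype n] [DecidableEq n]
    {A : Matrix n n ℂ} (hA : A.IsHermitian) : ℕ :=
  Fintype.card {i : n // 0 < hA.eigenvalues i}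

/-- `i₋(A)`: the number of negative eigenvalues, with multiplicity, of a Hermitian matrix. -/
noncomputable def inertiaNeg {n : Type*} [Fintype n] [DecidableEq n]
    {A : Matrix n n ℂ} (hA : A.IsHermitian) : ℕ :=
  Fintype.card {i : n // hA.eigenvalues i < 0}

/-- The minus partial ordering `Z ≤⁻ A`, i.e. `r(A - Z) = r(A) - r(Z)` (as integers). -/
def MinusLE {m n : Type*} [Fintype m] [Fintype n] (Z A : Matrix m n ℂ) : Prop :=
  ((A - Z).rank : ℤ) = (A.rank : ℤ) - (Z.rank : ℤ)

/-- The set `S₁` of Hermitian `Z` with `Z ≤⁻ A` and `R(Z) ⊆ R(B)`. -/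
def minusSet {m n : Type*} [Fintype m] [Fintype n]
    (A : Matrix m m ℂ) (B : Matrix m n ℂ) : Set (Matrix m m ℂ) :=
  {Z | Z.IsHermitian ∧ MinusLE Z A ∧
    LinearMap.range Z.mulVecLin ≤ LinearMap.range B.mulVecLin}

/-- `Z` is a shorted matrix of `A` relative to `R(B)` in the minus partial ordering:
a member of `S₁` of maximal possible rank. -/
def IsMinusShorted {m n : Type*} [Fintype m] [Fintype n]
    (A : Matrix m m ℂ) (B : Matrix m n ℂ) (Z : Matrix m m ℂ) : Prop :=
  Z ∈ minusSet A B ∧ ∀ Z' ∈ minusSet A B, Z'.rank ≤ Z.rank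

/-- `M = [[A, B], [B*, 0]]`. -/
def matM {m n : Type*} (A : Matrix m m ℂ) (B : Matrix m n ℂ) :
    Matrix (m ⊕ n) (m ⊕ n) ℂ :=
  Matrix.fromBlocks A B Bᴴ 0

theorem matM_isHermitian {m n : Type*} {A : Matrix m m ℂ} (hA : A.IsHermitian)
    (B : Matrix m n ℂ) : (matM A B).IsHermitian :=
  Matrix.IsHermitian.fromBlocks hA rfl Matrix.isHermitian_zero

/-- `H = [B, -A]`. -/
def matH {m n : Type*} (A : Matrix m m ℂ) (B : Matrix m n ℂ) : Matrix m (n ⊕ m) ℂ :=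
  Matrix.fromCols B (-A)

/-- `Î_n = [I_n, 0]`. -/
def hatI (m n : Type*) [DecidableEq n] : Matrix n (n ⊕ m) ℂ :=
  Matrix.fromCols 1 0

/-- `B̂ = [B, 0]`, with a zero block of `m` columns. -/
def hatB {m n : Type*} (B : Matrix m n ℂ) : Matrix m (n ⊕ m) ℂ :=
  Matrix.fromCols B 0

/-!
Let `P = B̂ F_H`; its range is `R(A) ∩ R(B)`, because `ker H` consists of the pairs `(x, y)` with
`B x = A y`. For Hermitian `Z`, the rank condition `Z ≤⁻ A` is equivalent to `R(Z) ⊆ R(A)` together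
with `Z A† Z = Z` (`minusLE_iff`). Hence `Z ∈ S₁` exactly when `Z` is Hermitian, `Z = P T` for some
`T`, and `Z A† Z = Z` (`mem_minusSet_iff`). For every `Q` the matrix `Q (Q* A† Q)† Q*` satisfies the
last equation, and choosing `Q = P U = [0, Z]` recovers a given `Z`; this gives both parametrizations
(`mem_minusSet_iff_exists`, `minusLE_conj_iff_exists`).

The extremal values follow from Sylvester's law in the form `i±(T* C T) ≤ i±(C)`. Put
`G = P* A† P`, the form `A†` on `R(A) ∩ R(B)`. An element `Z = P T` of `S₁` is the compression
`T* G T`, while `G = (A† P)* φ (A† P)` is a compression of `φ = P G† P*`. So the single matrix `φ`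
maximizes both inertias, with `i±(φ) = i±(G)`. Since inertia is subadditive, `Z ≤⁻ A` forces
`i±(A - Z) = i±(A) - i±(Z)`, which turns these maxima into the minima for `A - Z`.

It remains to express `i±(G)` through `M` (`inertia_matM`). With `C = (I - A A†) B`, the matrix `M` is
congruent to `[[A, C], [C*, -G']]`, where `G' = F_C B* A† B F_C` has the inertia of `G`. Because
`A C = 0` and `C G' = 0`, this is an orthogonal sum of `A`, `-G'` and `[[0, C], [C*, 0]]`, and the last
summand has both inertias equal to `r(C) = r[A, B] - r(A)`. Therefore
`i±(M) = i±(A) + i∓(G) + r[A, B] - r(A)`, that is, `i±(G) = i∓(M) + i±(A) - r[A, B]`.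
-/

/-! ### Inertia of Hermitian matrices -/

open scoped ComplexOrder in
/-- If `T* A T` is positive definite with `A = U diag(d) U*`, it remains so when the negative `dᵢ` are
replaced by zero, and then its rank is at most the number of positive `dᵢ`. The matrix `U` need not
be unitary. -/
theorem card_le_card_pos_of_posDef {n κ : Type*} [Fintype n] [DecidableEq n] [Fintype κ]
    (U : Matrix n n ℂ) (d : n → ℝ) (T : Matrix n κ ℂ)
    (h : (Tᴴ * (U * Matrix.diagonal (fun i => (d i : ℂ)) * Uᴴ) * T).PosDef) :
    Fintype.card κ ≤ Fintype.card {i : n // 0 < d i} := by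
  classical
  set P : Matrix n n ℂ := Matrix.diagonal (fun i => ((max (d i) 0 : ℝ) : ℂ)) with hP
  set N : Matrix n n ℂ := Matrix.diagonal (fun i => ((max (-d i) 0 : ℝ) : ℂ)) with hN
  have hN0 : N.PosSemidef := by
    rw [hN, Matrix.posSemidef_diagonal_iff]
    intro i
    exact_mod_cast le_max_right _ _
  have hPN : P = Matrix.diagonal (fun i => (d i : ℂ)) + N := by
    rw [hP, hN, Matrix.diagonal_add]
    congr 1
    funext i
    rw [← Complex.ofReal_add]
    congr 1
    rcases le_total 0 (d i) with h | h
    · rw [max_eq_left h, max_eq_right (by linarith)]; ring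
    · rw [max_eq_right h, max_eq_left (by linarith)]; ring
  have hsum : (Tᴴ * (U * P * Uᴴ) * T).PosDef := by
    have e : Tᴴ * (U * P * Uᴴ) * T
        = Tᴴ * (U * Matrix.diagonal (fun i => (d i : ℂ)) * Uᴴ) * T
          + Tᴴ * (U * N * Uᴴ) * T := by
      rw [hPN]; simp only [Matrix.mul_add, Matrix.add_mul]
    rw [e]
    exact h.add_posSemidef ((hN0.mul_mul_conjTranspose_same U).conjTranspose_mul_mul_same T)
  have hr : (Tᴴ * (U * P * Uᴴ) * T).rank = Fintype.card κ :=
    Matrix.rank_of_isUnit _ hsum.isUnit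
  have hle : (Tᴴ * (U * P * Uᴴ) * T).rank ≤ P.rank :=
    (Matrix.rank_mul_le_left _ _).trans <| (Matrix.rank_mul_le_right _ _).trans <|
      (Matrix.rank_mul_le_left _ _).trans <| Matrix.rank_mul_le_right _ _
  rw [hr, hP, Matrix.rank_diagonal] at hle
  refine hle.trans (Fintype.card_le_of_injective
    (fun i => ⟨i.1, ?_⟩) fun i j hij => Subtype.ext (congrArg (fun x => x.1) hij))
  by_contra hneg
  exact i.2 (by rw [max_eq_right (not_lt.mp hneg)]; simp)

theorem exists_conjTranspose_mul_mul_eq_one {n : Type*} [Fintype n] [DecidableEq n]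
    {U : Matrix n n ℂ} (hU : Uᴴ * U = 1) (d : n → ℝ) :
    ∃ T : Matrix n {i : n // 0 < d i} ℂ,
      Tᴴ * (U * Matrix.diagonal (fun i => (d i : ℂ)) * Uᴴ) * T = 1 := by
  set S : Matrix n {i : n // 0 < d i} ℂ :=
    (Matrix.diagonal (fun i => (((Real.sqrt (d i))⁻¹ : ℝ) : ℂ))).submatrix id Subtype.val with hS
  refine ⟨U * S, ?_⟩
  have e : (U * S)ᴴ * (U * Matrix.diagonal (fun i => (d i : ℂ)) * Uᴴ) * (U * S)
      = Sᴴ * Matrix.diagonal (fun i => (d i : ℂ)) * S := by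
    rw [Matrix.conjTranspose_mul]
    calc _ = Sᴴ * (Uᴴ * U) * Matrix.diagonal (fun i => (d i : ℂ)) * (Uᴴ * U) * S := by
          simp only [Matrix.mul_assoc]
      _ = _ := by rw [hU, Matrix.mul_one, Matrix.mul_one]
  rw [e]
  ext i j
  rw [Matrix.mul_apply, Finset.sum_eq_single j.1]
  · by_cases hij : i = j
    · subst hij
      have hi := i.2
      have hs : Real.sqrt (d i) ≠ 0 := (Real.sqrt_pos.mpr hi).ne'
      rw [Matrix.mul_diagonal, Matrix.one_apply_eq]
      simp only [hS, Matrix.conjTranspose_apply, Matrix.submatrix_apply, id,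
        Matrix.diagonal_apply_eq, Complex.star_def, Complex.conj_ofReal]
      rw [← Complex.ofReal_mul, ← Complex.ofReal_mul, ← Complex.ofReal_one]
      congr 1
      nth_rewrite 2 [← Real.mul_self_sqrt hi.le]
      field_simp
    · have : j.1 ≠ i.1 := fun h => hij (Subtype.ext h.symm)
      rw [Matrix.mul_diagonal]
      simp [hS, Matrix.one_apply_ne hij, Matrix.diagonal_apply_ne _ this]
  · intro k _ hk
    simp [hS, Matrix.diagonal_apply_ne _ hk]
  · simp

section Inertia

variable {n κ : Type*} [Fintype n] [DecidableEq n] [Fintype κ]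

theorem Matrix.IsHermitian.eq_eigenvectorUnitary_mul_diagonal {A : Matrix n n ℂ}
    (hA : A.IsHermitian) :
    A = (hA.eigenvectorUnitary : Matrix n n ℂ)
      * Matrix.diagonal (fun i => (hA.eigenvalues i : ℂ))
      * (hA.eigenvectorUnitary : Matrix n n ℂ)ᴴ := by
  have := hA.spectral_theorem
  rw [Unitary.conjStarAlgAut_apply] at this
  exact this

open scoped ComplexOrder in
/-- No compression of `A` to more than `i₊(A)` dimensions is positive definite. -/
theorem card_le_inertiaPos {A : Matrix n n ℂ} (hA : A.IsHermitian) (T : Matrix n κ ℂ)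
    (h : (Tᴴ * A * T).PosDef) : Fintype.card κ ≤ inertiaPos hA := by
  have := card_le_card_pos_of_posDef hA.eigenvectorUnitary hA.eigenvalues T
  rw [← hA.eq_eigenvectorUnitary_mul_diagonal] at this
  exact this h

/-- The bound `card_le_inertiaPos` is attained, by rescaled eigenvectors. -/
theorem exists_compression_eq_one {A : Matrix n n ℂ} (hA : A.IsHermitian) :
    ∃ T : Matrix n {i // 0 < hA.eigenvalues i} ℂ, Tᴴ * A * T = 1 := by
  have := exists_conjTranspose_mul_mul_eq_one
    (Unitary.coe_star_mul_self hA.eigenvectorUnitary) hA.eigenvalues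
  rw [← hA.eq_eigenvectorUnitary_mul_diagonal] at this
  exact this

open scoped ComplexOrder in
theorem inertiaNeg_eq_inertiaPos_neg {A : Matrix n n ℂ} (hA : A.IsHermitian)
    (hA' : (-A).IsHermitian) : inertiaNeg hA = inertiaPos hA' := by
  have hspec : -A = (hA.eigenvectorUnitary : Matrix n n ℂ)
      * Matrix.diagonal (fun i => ((-hA.eigenvalues i : ℝ) : ℂ))
      * (hA.eigenvectorUnitary : Matrix n n ℂ)ᴴ := by
    conv_lhs => rw [hA.eq_eigenvectorUnitary_mul_diagonal]
    have : Matrix.diagonal (fun i => ((-hA.eigenvalues i : ℝ) : ℂ))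
        = -Matrix.diagonal (fun i => (hA.eigenvalues i : ℂ)) := by
      rw [Matrix.diagonal_neg]; congr 1; funext i; simp
    rw [this, Matrix.mul_neg, Matrix.neg_mul]
  have hcard : inertiaNeg hA = Fintype.card {i // 0 < -hA.eigenvalues i} :=
    Fintype.card_congr (Equiv.subtypeEquivRight fun i => by simp)
  rw [hcard]
  apply le_antisymm
  · obtain ⟨T, hT⟩ := exists_conjTranspose_mul_mul_eq_one
      (Unitary.coe_star_mul_self hA.eigenvectorUnitary) (fun i => -hA.eigenvalues i)
    apply card_le_inertiaPos hA' T
    have hT' : Tᴴ * -A * T = 1 := by rw [hspec]; exact hT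
    rw [hT']
    exact Matrix.PosDef.one
  · obtain ⟨T, hT⟩ := exists_compression_eq_one hA'
    apply card_le_card_pos_of_posDef hA.eigenvectorUnitary (fun i => -hA.eigenvalues i) T
    rw [← hspec, hT]
    exact Matrix.PosDef.one

theorem rank_eq_inertiaPos_add_inertiaNeg {A : Matrix n n ℂ} (hA : A.IsHermitian) :
    A.rank = inertiaPos hA + inertiaNeg hA := by
  classical
  rw [hA.rank_eq_card_non_zero_eigs, inertiaPos, inertiaNeg,
    ← Fintype.card_subtype_or_disjoint]
  · exact Fintype.card_congr (Equiv.subtypeEquivRight fun i => by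
      rw [ne_iff_lt_or_gt, or_comm])
  · rw [Pi.disjoint_iff]
    intro i
    rw [Prop.disjoint_iff]
    rintro ⟨h1, h2⟩
    exact lt_asymm h1 h2

theorem inertiaPos_congr {A D : Matrix n n ℂ} (h : A = D) (hA : A.IsHermitian)
    (hD : D.IsHermitian) : inertiaPos hA = inertiaPos hD := by subst h; rfl

theorem inertiaNeg_congr {A D : Matrix n n ℂ} (h : A = D) (hA : A.IsHermitian)
    (hD : D.IsHermitian) : inertiaNeg hA = inertiaNeg hD := by subst h; rfl

open scoped ComplexOrder in
/-- Compression does not increase the positive inertia (half of Sylvester's law). -/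
theorem inertiaPos_le_of_eq_compression [DecidableEq κ] {C : Matrix n n ℂ}
    {D : Matrix κ κ ℂ}
    (hC : C.IsHermitian) (hD : D.IsHermitian) (T : Matrix n κ ℂ) (h : D = Tᴴ * C * T) :
    inertiaPos hD ≤ inertiaPos hC := by
  obtain ⟨S, hS⟩ := exists_compression_eq_one hD
  apply card_le_inertiaPos hC (T * S)
  have e : (T * S)ᴴ * C * (T * S) = Sᴴ * (Tᴴ * C * T) * S := by
    rw [Matrix.conjTranspose_mul]; simp only [Matrix.mul_assoc]
  rw [e, ← h, hS]
  exact Matrix.PosDef.one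

theorem inertiaNeg_le_of_eq_compression [DecidableEq κ] {C : Matrix n n ℂ}
    {D : Matrix κ κ ℂ}
    (hC : C.IsHermitian) (hD : D.IsHermitian) (T : Matrix n κ ℂ) (h : D = Tᴴ * C * T) :
    inertiaNeg hD ≤ inertiaNeg hC := by
  rw [inertiaNeg_eq_inertiaPos_neg hC hC.neg, inertiaNeg_eq_inertiaPos_neg hD hD.neg]
  exact inertiaPos_le_of_eq_compression hC.neg hD.neg T (by rw [h, Matrix.mul_neg, Matrix.neg_mul])

end Inertia

/-! ### Moore–Penrose inverses -/

section PseudoInverse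

variable {m n : Type*} [Fintype m] [Fintype n]

theorem mul_pinv_mul_self (A : Matrix m n ℂ) : A * pinv A * A = A :=
  (isMoorePenrose_pinv A).mul_mul_self

theorem pinv_mul_self_mul_pinv (A : Matrix m n ℂ) : pinv A * A * pinv A = pinv A :=
  (isMoorePenrose_pinv A).self_mul_mul

theorem pinv_eq {A : Matrix m n ℂ} {X : Matrix n m ℂ} (h : IsMoorePenrose A X) : pinv A = X :=
  (isMoorePenrose_pinv A).unique h

theorem isHermitian_pinv {A : Matrix n n ℂ} (hA : A.IsHermitian) : (pinv A).IsHermitian := by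
  classical
  obtain ⟨X, hX, h⟩ := exists_isMoorePenrose_of_isHermitian hA
  rw [pinv_eq h]
  exact hX

theorem mul_pinv_comm {A : Matrix n n ℂ} (hA : A.IsHermitian) : A * pinv A = pinv A * A := by
  have h := (isMoorePenrose_pinv A).isHermitian_left.eq
  rw [Matrix.conjTranspose_mul, hA.eq, (isHermitian_pinv hA).eq] at h
  exact h.symm

theorem pinv_mul_eq_zero {p : Type*} {A : Matrix m n ℂ} {X : Matrix m p ℂ} (h : Aᴴ * X = 0) :
    pinv A * X = 0 := by
  have hl := (isMoorePenrose_pinv A).isHermitian_left.eq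
  rw [Matrix.conjTranspose_mul] at hl
  rw [← pinv_mul_self_mul_pinv A, Matrix.mul_assoc (pinv A), ← hl, Matrix.mul_assoc,
    Matrix.mul_assoc, h, Matrix.mul_zero, Matrix.mul_zero]

variable [DecidableEq n]

theorem isHermitian_projF (A : Matrix m n ℂ) : (projF A).IsHermitian :=
  Matrix.isHermitian_one.sub (isMoorePenrose_pinv A).isHermitian_right

theorem mul_projF (A : Matrix m n ℂ) : A * projF A = 0 := by
  rw [projF, Matrix.mul_sub, Matrix.mul_one, ← Matrix.mul_assoc, mul_pinv_mul_self, sub_self]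

theorem projF_mul_of_mul_eq_zero {p : Type*} {A : Matrix m n ℂ} {X : Matrix n p ℂ}
    (h : A * X = 0) : projF A * X = X := by
  rw [projF, Matrix.sub_mul, Matrix.one_mul, Matrix.mul_assoc, h, Matrix.mul_zero, sub_zero]

end PseudoInverse

/-! ### Orthogonal sums -/

theorem Matrix.rank_add_le {m n : Type*} [Fintype m] [Fintype n] (X Y : Matrix m n ℂ) :
    (X + Y).rank ≤ X.rank + Y.rank := by
  rw [Matrix.rank, Matrix.rank, Matrix.rank, Matrix.mulVecLin_add]
  exact (Submodule.finrank_mono (LinearMap.range_add_le _ _)).trans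
    (Submodule.finrank_add_le_finrank_add_finrank _ _)

section OrthogonalSum

variable {n : Type*} [Fintype n] [DecidableEq n]

open scoped ComplexOrder in
theorem inertiaPos_add_le_of_mul_eq_zero {X Y : Matrix n n ℂ} (hX : X.IsHermitian)
    (hY : Y.IsHermitian) (hXY : X * Y = 0) :
    inertiaPos hX + inertiaPos hY ≤ inertiaPos (hX.add hY) := by
  -- a compression of `X` to the identity can be moved into the range of `X`, which `Y` kills
  have key : ∀ {X Y : Matrix n n ℂ} (hX : X.IsHermitian) (hYX : Y * X = 0),
      ∃ T : Matrix n {i // 0 < hX.eigenvalues i} ℂ, Tᴴ * X * T = 1 ∧ Y * T = 0 := by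
    intro X Y hX hYX
    obtain ⟨T, hT⟩ := exists_compression_eq_one hX
    refine ⟨pinv X * X * T, ?_, ?_⟩
    · rw [← hT, Matrix.conjTranspose_mul, (isMoorePenrose_pinv X).isHermitian_right.eq,
        ← mul_pinv_comm hX]
      calc Tᴴ * (X * pinv X) * X * (X * pinv X * T)
          = Tᴴ * (X * pinv X * X) * (X * pinv X) * T := by simp only [Matrix.mul_assoc]
        _ = Tᴴ * (X * (X * pinv X)) * T := by
            rw [mul_pinv_mul_self]; simp only [Matrix.mul_assoc]
        _ = Tᴴ * X * T := by
            rw [mul_pinv_comm hX, ← Matrix.mul_assoc X, mul_pinv_mul_self]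
    · rw [← mul_pinv_comm hX, ← Matrix.mul_assoc, ← Matrix.mul_assoc, hYX, Matrix.zero_mul,
        Matrix.zero_mul]
  have hYX : Y * X = 0 := by
    have := congrArg Matrix.conjTranspose hXY
    rwa [Matrix.conjTranspose_mul, hX.eq, hY.eq, Matrix.conjTranspose_zero] at this
  obtain ⟨S, hS, hYS⟩ := key hX hYX
  obtain ⟨T, hT, hXT⟩ := key hY hXY
  have hc := card_le_inertiaPos (hX.add hY) (Matrix.fromCols S T) (by
    have h1 : (X + Y) * Matrix.fromCols S T = Matrix.fromCols (X * S) (Y * T) := by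
      rw [Matrix.mul_fromCols, Matrix.add_mul, Matrix.add_mul, hYS, hXT, add_zero, zero_add]
    have hSY : Sᴴ * Y = 0 := by
      have := congrArg Matrix.conjTranspose hYS
      rwa [Matrix.conjTranspose_mul, hY.eq, Matrix.conjTranspose_zero] at this
    have hTX : Tᴴ * X = 0 := by
      have := congrArg Matrix.conjTranspose hXT
      rwa [Matrix.conjTranspose_mul, hX.eq, Matrix.conjTranspose_zero] at this
    rw [Matrix.mul_assoc, h1, Matrix.conjTranspose_fromCols_eq_fromRows_conjTranspose,
      Matrix.fromRows_mul_fromCols, ← Matrix.mul_assoc, ← Matrix.mul_assoc, ← Matrix.mul_assoc,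
      ← Matrix.mul_assoc, hS, hT, hSY, hTX, Matrix.zero_mul, Matrix.zero_mul,
      Matrix.fromBlocks_one]
    exact Matrix.PosDef.one)
  rwa [Fintype.card_sum] at hc

/-- Both inertias and the rank are additive on Hermitian matrices with product zero. The lower
bounds for the two inertias add up to the upper bound `r(X + Y) ≤ r(X) + r(Y)`. -/
theorem inertia_add_of_mul_eq_zero {X Y : Matrix n n ℂ} (hX : X.IsHermitian)
    (hY : Y.IsHermitian) (hXY : X * Y = 0) (hS : (X + Y).IsHermitian) :
    inertiaPos hS = inertiaPos hX + inertiaPos hY ∧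
      inertiaNeg hS = inertiaNeg hX + inertiaNeg hY := by
  have h1 := inertiaPos_add_le_of_mul_eq_zero hX hY hXY
  have h2 := inertiaPos_add_le_of_mul_eq_zero hX.neg hY.neg (by rw [neg_mul_neg, hXY])
  rw [← inertiaNeg_eq_inertiaPos_neg hX, ← inertiaNeg_eq_inertiaPos_neg hY,
    inertiaPos_congr (neg_add X Y).symm _ hS.neg, ← inertiaNeg_eq_inertiaPos_neg hS] at h2
  have h3 := Matrix.rank_add_le X Y
  rw [rank_eq_inertiaPos_add_inertiaNeg hX, rank_eq_inertiaPos_add_inertiaNeg hY,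
    rank_eq_inertiaPos_add_inertiaNeg hS] at h3
  change _ ≤ inertiaPos hS at h1
  omega

theorem rank_add_of_mul_eq_zero {X Y : Matrix n n ℂ} (hX : X.IsHermitian)
    (hY : Y.IsHermitian) (hXY : X * Y = 0) : (X + Y).rank = X.rank + Y.rank := by
  have h := inertia_add_of_mul_eq_zero hX hY hXY (hX.add hY)
  rw [rank_eq_inertiaPos_add_inertiaNeg hX, rank_eq_inertiaPos_add_inertiaNeg hY,
    rank_eq_inertiaPos_add_inertiaNeg (hX.add hY)]
  omega

end OrthogonalSum

/-! ### The minus partial ordering -/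

theorem exists_eq_mul_of_range_le {m n p : Type*} [Fintype n] [Fintype p] [DecidableEq p]
    {Z : Matrix m p ℂ} {B : Matrix m n ℂ}
    (h : LinearMap.range Z.mulVecLin ≤ LinearMap.range B.mulVecLin) :
    ∃ Y : Matrix n p ℂ, Z = B * Y := by
  have hcol : ∀ j, ∃ y, B.mulVecLin y = Z.col j := fun j =>
    h ⟨Pi.single j 1, by simp⟩
  choose y hy using hcol
  refine ⟨Matrix.of fun i j => y j i, ?_⟩
  ext i j
  have := congrFun (hy j) i
  simpa [Matrix.mul_apply, Matrix.mulVec, dotProduct] using this.symm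

theorem range_mul_le {m n p : Type*} [Fintype n] [Fintype p]
    (B : Matrix m n ℂ) (Y : Matrix n p ℂ) :
    LinearMap.range (B * Y).mulVecLin ≤ LinearMap.range B.mulVecLin := by
  rw [Matrix.mulVecLin_mul]
  exact LinearMap.range_comp_le_range _ _

/-- A matrix whose range lies in two subspaces that meet trivially is zero. -/
theorem eq_zero_of_range_disjoint {m p : Type*} [Fintype m] [Fintype p] [DecidableEq p]
    {Z W : Matrix m m ℂ}
    (h : Disjoint (LinearMap.range Z.mulVecLin) (LinearMap.range W.mulVecLin))
    {Y Y' : Matrix m p ℂ} (hY : Z * Y = W * Y') : Z * Y = 0 := by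
  have h0 : LinearMap.range (Z * Y).mulVecLin ≤ ⊥ :=
    h (range_mul_le Z Y) (hY ▸ range_mul_le W Y')
  have h1 : (Z * Y).mulVecLin = 0 := LinearMap.range_eq_bot.mp (le_bot_iff.mp h0)
  exact Matrix.ext_iff_mulVec.mpr fun v => by
    simpa using LinearMap.congr_fun h1 v

/-- For Hermitian matrices, `Z ≤⁻ A` means that `R(Z) ⊆ R(A)` (written `A A† Z = Z`) and that `A†`
is an inner inverse of `Z`. The rank condition makes `R(A)` the direct sum of `R(Z)` and
`R(A - Z)`, and `Z - Z A† Z` has its range in both summands. -/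
theorem minusLE_iff {m : Type*} [Fintype m] [DecidableEq m] {Z A : Matrix m m ℂ}
    (hZ : Z.IsHermitian) (hA : A.IsHermitian) :
    MinusLE Z A ↔ A * pinv A * Z = Z ∧ Z * pinv A * Z = Z := by
  have hflip : A * pinv A * Z = Z → Z * pinv A * A = Z := by
    intro h
    have := congrArg Matrix.conjTranspose h
    rwa [Matrix.conjTranspose_mul, Matrix.conjTranspose_mul, hZ.eq, hA.eq,
      (isHermitian_pinv hA).eq, ← Matrix.mul_assoc] at this
  set RZ := LinearMap.range Z.mulVecLin with hRZ
  set RW := LinearMap.range (A - Z).mulVecLin with hRW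
  set RA := LinearMap.range A.mulVecLin with hRA
  have hdim : Module.finrank ℂ ↥(RZ ⊔ RW) + Module.finrank ℂ ↥(RZ ⊓ RW)
      = Z.rank + (A - Z).rank := Submodule.finrank_sup_add_finrank_inf_eq RZ RW
  have hle : RA ≤ RZ ⊔ RW := by
    have : A.mulVecLin = Z.mulVecLin + (A - Z).mulVecLin := by
      rw [← Matrix.mulVecLin_add]; congr 1; abel
    rw [hRA, this]
    exact LinearMap.range_add_le _ _
  have hrA : Module.finrank ℂ ↥RA = A.rank := rfl
  rw [MinusLE]
  constructor
  · intro h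
    have hsup := Submodule.finrank_mono hle
    have heq : RA = RZ ⊔ RW := Submodule.eq_of_le_of_finrank_le hle (by omega)
    have hdisj : Disjoint RZ RW := by
      rw [disjoint_iff, ← Submodule.finrank_eq_zero (R := ℂ)]
      omega
    obtain ⟨Y, hY⟩ := exists_eq_mul_of_range_le (Z := Z) (B := A)
      (show RZ ≤ RA from heq ▸ le_sup_left)
    have hAZ : A * pinv A * Z = Z := by
      rw [hY, ← Matrix.mul_assoc, mul_pinv_mul_self]
    refine ⟨hAZ, ?_⟩
    have := eq_zero_of_range_disjoint hdisj (Y := 1 - pinv A * Z) (Y' := pinv A * Z) (by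
      rw [Matrix.mul_sub, Matrix.sub_mul, Matrix.mul_one, ← Matrix.mul_assoc, ← Matrix.mul_assoc,
        hAZ])
    rw [Matrix.mul_sub, Matrix.mul_one, ← Matrix.mul_assoc, sub_eq_zero] at this
    exact this.symm
  · rintro ⟨h1, h2⟩
    have h3 := hflip h1
    have hdisj : RZ ⊓ RW = ⊥ := by
      rw [eq_bot_iff]
      rintro v ⟨⟨y, hy⟩, ⟨x, hx⟩⟩
      have e1 : (Z * pinv A).mulVec v = v := by
        rw [← hy, Matrix.mulVecLin_apply, Matrix.mulVec_mulVec, h2]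
      have e2 : (Z * pinv A).mulVec v = 0 := by
        rw [← hx, Matrix.mulVecLin_apply, Matrix.mulVec_mulVec, Matrix.mul_sub, h3, h2, sub_self,
          Matrix.zero_mulVec]
      exact (Submodule.mem_bot ℂ).mpr (e1.symm.trans e2)
    have hge : RZ ⊔ RW ≤ RA := by
      apply sup_le
      · rw [hRZ, ← h1, Matrix.mul_assoc]; exact range_mul_le _ _
      · have : A - Z = A * (1 - pinv A * Z) := by
          rw [Matrix.mul_sub, Matrix.mul_one, ← Matrix.mul_assoc, h1]
        rw [hRW, this]; exact range_mul_le _ _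
    rw [le_antisymm hge hle, hdisj, finrank_bot] at hdim
    omega

/-! ### Inertia of block matrices -/

section Blocks

variable {m n : Type*} [Fintype m] [Fintype n] [DecidableEq m] [DecidableEq n]

theorem inertia_fromBlocks_diag {A : Matrix m m ℂ} {D : Matrix n n ℂ} (hA : A.IsHermitian)
    (hD : D.IsHermitian) (h : (Matrix.fromBlocks A 0 0 D).IsHermitian) :
    inertiaPos h = inertiaPos hA + inertiaPos hD ∧
      inertiaNeg h = inertiaNeg hA + inertiaNeg hD := by
  have hA' : (Matrix.fromBlocks A 0 0 (0 : Matrix n n ℂ)).IsHermitian :=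
    hA.fromBlocks (by simp) Matrix.isHermitian_zero
  have hD' : (Matrix.fromBlocks (0 : Matrix m m ℂ) 0 0 D).IsHermitian :=
    Matrix.isHermitian_zero.fromBlocks (by simp) hD
  have hsum : Matrix.fromBlocks A 0 0 (0 : Matrix n n ℂ)
      + Matrix.fromBlocks (0 : Matrix m m ℂ) 0 0 D = Matrix.fromBlocks A 0 0 D := by
    simp [Matrix.fromBlocks_add]
  have hadd := inertia_add_of_mul_eq_zero hA' hD' (by simp [Matrix.fromBlocks_multiply])
    (hsum ▸ h)
  have a1 : A = (Matrix.fromRows (1 : Matrix m m ℂ) (0 : Matrix n m ℂ))ᴴ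
      * Matrix.fromBlocks A 0 0 (0 : Matrix n n ℂ)
      * Matrix.fromRows (1 : Matrix m m ℂ) (0 : Matrix n m ℂ) := by
    rw [Matrix.conjTranspose_fromRows_eq_fromCols_conjTranspose]
    simp [Matrix.fromCols_mul_fromBlocks, Matrix.fromCols_mul_fromRows]
  have a2 : Matrix.fromBlocks A 0 0 (0 : Matrix n n ℂ)
      = (Matrix.fromCols (1 : Matrix m m ℂ) (0 : Matrix m n ℂ))ᴴ * A
        * Matrix.fromCols (1 : Matrix m m ℂ) (0 : Matrix m n ℂ) := by
    rw [Matrix.conjTranspose_fromCols_eq_fromRows_conjTranspose]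
    rw [Matrix.fromRows_mul, Matrix.fromRows_mul_fromCols]
    simp
  have d1 : D = (Matrix.fromRows (0 : Matrix m n ℂ) (1 : Matrix n n ℂ))ᴴ
      * Matrix.fromBlocks (0 : Matrix m m ℂ) 0 0 D
      * Matrix.fromRows (0 : Matrix m n ℂ) (1 : Matrix n n ℂ) := by
    rw [Matrix.conjTranspose_fromRows_eq_fromCols_conjTranspose]
    simp [Matrix.fromCols_mul_fromBlocks, Matrix.fromCols_mul_fromRows]
  have d2 : Matrix.fromBlocks (0 : Matrix m m ℂ) 0 0 D
      = (Matrix.fromCols (0 : Matrix n m ℂ) (1 : Matrix n n ℂ))ᴴ * D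
        * Matrix.fromCols (0 : Matrix n m ℂ) (1 : Matrix n n ℂ) := by
    rw [Matrix.conjTranspose_fromCols_eq_fromRows_conjTranspose]
    rw [Matrix.fromRows_mul, Matrix.fromRows_mul_fromCols]
    simp
  have pA := le_antisymm (inertiaPos_le_of_eq_compression hA hA' _ a2)
    (inertiaPos_le_of_eq_compression hA' hA _ a1)
  have nA := le_antisymm (inertiaNeg_le_of_eq_compression hA hA' _ a2)
    (inertiaNeg_le_of_eq_compression hA' hA _ a1)
  have pD := le_antisymm (inertiaPos_le_of_eq_compression hD hD' _ d2)
    (inertiaPos_le_of_eq_compression hD' hD _ d1)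
  have nD := le_antisymm (inertiaNeg_le_of_eq_compression hD hD' _ d2)
    (inertiaNeg_le_of_eq_compression hD' hD _ d1)
  rw [pA, nA, pD, nD] at hadd
  have hp : inertiaPos (hsum ▸ h : (_ + _ : Matrix (m ⊕ n) (m ⊕ n) ℂ).IsHermitian)
      = inertiaPos h := inertiaPos_congr hsum _ _
  have hn : inertiaNeg (hsum ▸ h : (_ + _ : Matrix (m ⊕ n) (m ⊕ n) ℂ).IsHermitian)
      = inertiaNeg h := inertiaNeg_congr hsum _ _
  rw [hp, hn] at hadd
  exact hadd

open scoped ComplexOrder in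
theorem inertiaPos_eq_rank_of_posSemidef {A : Matrix n n ℂ} (hA : A.PosSemidef) :
    inertiaPos hA.1 = A.rank := by
  have : inertiaNeg hA.1 = 0 :=
    Fintype.card_eq_zero_iff.mpr ⟨fun i => absurd i.2 (not_lt.mpr (hA.eigenvalues_nonneg _))⟩
  rw [rank_eq_inertiaPos_add_inertiaNeg hA.1, this, add_zero]

open scoped ComplexOrder in
theorem inertia_fromBlocks_antidiag (C : Matrix m n ℂ)
    (h : (Matrix.fromBlocks 0 C Cᴴ 0).IsHermitian) :
    inertiaPos h = C.rank ∧ inertiaNeg h = C.rank := by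
  have hps : (Cᴴ * C + Cᴴ * C).PosSemidef :=
    (Matrix.posSemidef_conjTranspose_mul_self C).add (Matrix.posSemidef_conjTranspose_mul_self C)
  have hrk : C.rank ≤ (Cᴴ * C + Cᴴ * C).rank := by
    rw [← Matrix.rank_conjTranspose_mul_self C]
    have : Cᴴ * C = (Cᴴ * C + Cᴴ * C) * ((2 : ℂ)⁻¹ • 1) := by
      rw [← two_smul ℂ, Matrix.mul_smul, Matrix.mul_one, smul_smul]; norm_num
    conv_lhs => rw [this]
    exact Matrix.rank_mul_le_left _ _
  have hpos : C.rank ≤ inertiaPos h := by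
    refine (hrk.trans (inertiaPos_eq_rank_of_posSemidef hps).ge).trans
      (inertiaPos_le_of_eq_compression h hps.1 (Matrix.fromRows C 1) ?_)
    rw [Matrix.conjTranspose_fromRows_eq_fromCols_conjTranspose]
    simp [Matrix.fromCols_mul_fromBlocks, Matrix.fromCols_mul_fromRows]
  have hneg : C.rank ≤ inertiaNeg h := by
    rw [inertiaNeg_eq_inertiaPos_neg h h.neg]
    refine (hrk.trans (inertiaPos_eq_rank_of_posSemidef hps).ge).trans
      (inertiaPos_le_of_eq_compression h.neg hps.1 (Matrix.fromRows (-C) 1) ?_)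
    rw [Matrix.conjTranspose_fromRows_eq_fromCols_conjTranspose]
    simp [Matrix.fromCols_mul_fromBlocks, Matrix.fromCols_mul_fromRows]
  have hle : (Matrix.fromBlocks 0 C Cᴴ 0).rank ≤ C.rank + C.rank := by
    have e : Matrix.fromBlocks 0 C Cᴴ 0
        = Matrix.fromRows (1 : Matrix m m ℂ) (0 : Matrix n m ℂ)
            * (C * Matrix.fromCols (0 : Matrix n m ℂ) (1 : Matrix n n ℂ))
          + Matrix.fromRows (0 : Matrix m n ℂ) (1 : Matrix n n ℂ)
            * (Cᴴ * Matrix.fromCols (1 : Matrix m m ℂ) (0 : Matrix m n ℂ)) := by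
      rw [Matrix.mul_fromCols C, Matrix.mul_fromCols Cᴴ, Matrix.fromRows_mul_fromCols,
        Matrix.fromRows_mul_fromCols, Matrix.fromBlocks_add]
      simp
    rw [e]
    refine (Matrix.rank_add_le _ _).trans (add_le_add ?_ ?_)
    · exact (Matrix.rank_mul_le_right _ _).trans (Matrix.rank_mul_le_left _ _)
    · exact (Matrix.rank_mul_le_right _ _).trans ((Matrix.rank_mul_le_left _ _).trans
        (Matrix.rank_conjTranspose C).le)
  rw [rank_eq_inertiaPos_add_inertiaNeg h] at hle
  omega

end Blocks

/-! ### Inertia of the bordered matrix -/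

section Bordered

/-- The part `(I - A A†) B` of `B` transversal to `R(A)`. -/
noncomputable def residualMatrix {m n : Type*} [Fintype m]
    (A : Matrix m m ℂ) (B : Matrix m n ℂ) : Matrix m n ℂ :=
  B - A * (pinv A * B)

theorem mul_residualMatrix {m n : Type*} [Fintype m] {A : Matrix m m ℂ} (hA : A.IsHermitian)
    (B : Matrix m n ℂ) : A * residualMatrix A B = 0 := by
  rw [residualMatrix, Matrix.mul_sub, ← Matrix.mul_assoc A (pinv A) B, mul_pinv_comm hA,
    ← Matrix.mul_assoc A (pinv A * A) B, ← Matrix.mul_assoc A (pinv A) A, mul_pinv_mul_self,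
    sub_self]

/-- The form `x ↦ x* B* A† B x` restricted to `{x | B x ∈ R(A)}`. -/
noncomputable def residualForm {m n : Type*} [Fintype m] [Fintype n] [DecidableEq n]
    (A : Matrix m m ℂ) (B : Matrix m n ℂ) : Matrix n n ℂ :=
  projF (residualMatrix A B) * (Bᴴ * pinv A * B) * projF (residualMatrix A B)

theorem isHermitian_residualForm {m n : Type*} [Fintype m] [Fintype n] [DecidableEq n]
    {A : Matrix m m ℂ} (hA : A.IsHermitian) (B : Matrix m n ℂ) :
    (residualForm A B).IsHermitian := by
  have h := Matrix.isHermitian_conjTranspose_mul_mul (projF (residualMatrix A B))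
    (Matrix.isHermitian_conjTranspose_mul_mul B (isHermitian_pinv hA))
  rwa [(isHermitian_projF _).eq] at h

/-- The congruence by `[[I, W], [0, I]]` turns `M` into `[[A, C], [C*, -residualForm A B]]` with
`C = (I - A A†) B`. Here `W = -A† B + X`: the first summand replaces `B` by `C`, the second uses the
columns of `C` to remove everything from the corner `-D = -B* A† B` except its compression to
`ker C`. -/
theorem exists_congruence_matM {m n : Type*} [Fintype m] [Fintype n] [DecidableEq n]
    {A : Matrix m m ℂ} (hA : A.IsHermitian) (B : Matrix m n ℂ) :
    ∃ W : Matrix m n ℂ, A * W + B = residualMatrix A B ∧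
      Wᴴ * (A * W + B) + Bᴴ * W = -residualForm A B := by
  set C := residualMatrix A B with hC
  have hAC : A * C = 0 := mul_residualMatrix hA B
  have hCA : Cᴴ * A = 0 := by
    have := congrArg Matrix.conjTranspose hAC
    rwa [Matrix.conjTranspose_mul, hA.eq, Matrix.conjTranspose_zero] at this
  have hPA : pinv C * A = 0 := pinv_mul_eq_zero hCA
  set D := Bᴴ * pinv A * B with hD
  set Q := pinv C * C with hQ
  have hDh : Dᴴ = D := (Matrix.isHermitian_conjTranspose_mul_mul B (isHermitian_pinv hA)).eq
  have hQh : Qᴴ = Q := (isMoorePenrose_pinv C).isHermitian_right.eq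
  -- `X = (C†)* Y` gives `X* C + C* X = Y* Q + Q Y`, which has to be `Q D + D Q - Q D Q`
  set Y := D - (2 : ℂ)⁻¹ • (D * Q) with hY
  set X := (pinv C)ᴴ * Y with hX
  have hAX : A * X = 0 := by
    have := congrArg Matrix.conjTranspose hPA
    rw [Matrix.conjTranspose_mul, hA.eq, Matrix.conjTranspose_zero] at this
    rw [hX, ← Matrix.mul_assoc, this, Matrix.zero_mul]
  have hpC : pinv A * C = 0 := pinv_mul_eq_zero (by rw [hA.eq, hAC])
  have hCX : Cᴴ * X = Q * Y := by
    rw [hX, ← Matrix.mul_assoc, ← Matrix.conjTranspose_mul, ← hQ, hQh]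
  have hBX : Bᴴ * X = Cᴴ * X := by
    rw [hC, residualMatrix, Matrix.conjTranspose_sub, Matrix.conjTranspose_mul, hA.eq, Matrix.sub_mul,
      Matrix.mul_assoc _ A, hAX, Matrix.mul_zero, sub_zero]
  have h1 : A * (-(pinv A * B) + X) + B = C := by
    rw [Matrix.mul_add, hAX, hC, residualMatrix, Matrix.mul_neg]; abel
  refine ⟨-(pinv A * B) + X, h1, ?_⟩
  have h2 : Xᴴ * C = Yᴴ * Q := by
    have := congrArg Matrix.conjTranspose hCX
    rwa [Matrix.conjTranspose_mul Cᴴ, Matrix.conjTranspose_mul Q, hQh,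
      Matrix.conjTranspose_conjTranspose] at this
  have h3 : Yᴴ = D - (2 : ℂ)⁻¹ • (Q * D) := by
    rw [hY, Matrix.conjTranspose_sub, Matrix.conjTranspose_smul, Matrix.conjTranspose_mul D, hDh,
      hQh]
    simp
  rw [h1, Matrix.conjTranspose_add, Matrix.add_mul, h2, Matrix.mul_add, hBX, hCX,
    Matrix.conjTranspose_neg, Matrix.conjTranspose_mul, (isHermitian_pinv hA).eq, Matrix.neg_mul,
    Matrix.mul_assoc _ (pinv A) C, hpC, Matrix.mul_zero, h3, hY, Matrix.mul_neg,
    ← Matrix.mul_assoc Bᴴ, residualForm, ← hC, ← hD, projF, ← hQ]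
  simp only [Matrix.sub_mul, Matrix.mul_sub, Matrix.one_mul, Matrix.mul_one, Matrix.smul_mul,
    Matrix.mul_smul, Matrix.mul_assoc]
  module

variable {m n : Type*} [Fintype m] [Fintype n] [DecidableEq m] [DecidableEq n]

open scoped ComplexOrder in
/-- Column operations replace `B` by `C = (I - A A†) B`, and `A A*`, `C C*` have product zero. -/
theorem rank_fromCols_eq {A : Matrix m m ℂ} (hA : A.IsHermitian) (B : Matrix m n ℂ) :
    (Matrix.fromCols A B).rank = A.rank + (residualMatrix A B).rank := by
  set C := residualMatrix A B with hC
  have hAC : A * C = 0 := mul_residualMatrix hA B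
  have e1 : Matrix.fromCols A C
      = Matrix.fromCols A B
          * Matrix.fromBlocks (1 : Matrix m m ℂ) (-(pinv A * B)) 0 (1 : Matrix n n ℂ) := by
    rw [Matrix.fromCols_mul_fromBlocks]
    simp [hC, residualMatrix, sub_eq_neg_add]
  have e2 : Matrix.fromCols A B
      = Matrix.fromCols A C
          * Matrix.fromBlocks (1 : Matrix m m ℂ) (pinv A * B) 0 (1 : Matrix n n ℂ) := by
    rw [Matrix.fromCols_mul_fromBlocks]
    simp [hC, residualMatrix]
  have hr : (Matrix.fromCols A B).rank = (Matrix.fromCols A C).rank := by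
    apply le_antisymm
    · rw [e2]; exact Matrix.rank_mul_le_left _ _
    · rw [e1]; exact Matrix.rank_mul_le_left _ _
  have hz : (A * Aᴴ) * (C * Cᴴ) = 0 := by
    rw [hA.eq, Matrix.mul_assoc, ← Matrix.mul_assoc A C, hAC, Matrix.zero_mul, Matrix.mul_zero]
  rw [hr, ← Matrix.rank_self_mul_conjTranspose,
    Matrix.conjTranspose_fromCols_eq_fromRows_conjTranspose, Matrix.fromCols_mul_fromRows,
    rank_add_of_mul_eq_zero (Matrix.isHermitian_mul_conjTranspose_self A)
      (Matrix.isHermitian_mul_conjTranspose_self C) hz,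
    Matrix.rank_self_mul_conjTranspose, Matrix.rank_self_mul_conjTranspose]

/-- `M` is congruent to `A ⊕ (-residualForm A B)` plus an antidiagonal part orthogonal to it, which
contributes `r[A, B] - r(A)` to each inertia. -/
theorem inertia_matM {A : Matrix m m ℂ} (hA : A.IsHermitian) (B : Matrix m n ℂ) :
    inertiaPos (matM_isHermitian hA B) + A.rank
        = inertiaPos hA + inertiaNeg (isHermitian_residualForm hA B)
          + (Matrix.fromCols A B).rank ∧
      inertiaNeg (matM_isHermitian hA B) + A.rank
        = inertiaNeg hA + inertiaPos (isHermitian_residualForm hA B)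
          + (Matrix.fromCols A B).rank := by
  obtain ⟨W, h1, h2⟩ := exists_congruence_matM hA B
  set C := residualMatrix A B with hC
  set G := residualForm A B with hG
  have hGh : G.IsHermitian := isHermitian_residualForm hA B
  have hAC : A * C = 0 := mul_residualMatrix hA B
  have hGC : G * Cᴴ = 0 := by
    have : C * G = 0 := by
      rw [hG, residualForm, ← hC, Matrix.mul_assoc, ← Matrix.mul_assoc C, mul_projF,
        Matrix.zero_mul]
    have := congrArg Matrix.conjTranspose this
    rwa [Matrix.conjTranspose_mul, hGh.eq, Matrix.conjTranspose_zero] at this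
  have hdiag : (Matrix.fromBlocks A 0 0 (-G)).IsHermitian := hA.fromBlocks (by simp) hGh.neg
  have hanti : (Matrix.fromBlocks 0 C Cᴴ 0).IsHermitian :=
    Matrix.isHermitian_zero.fromBlocks rfl Matrix.isHermitian_zero
  have hsum : Matrix.fromBlocks A 0 0 (-G) + Matrix.fromBlocks 0 C Cᴴ 0
      = Matrix.fromBlocks A C Cᴴ (-G) := by
    simp [Matrix.fromBlocks_add]
  have hM' : (Matrix.fromBlocks A C Cᴴ (-G)).IsHermitian := hA.fromBlocks rfl hGh.neg
  have hadd := inertia_add_of_mul_eq_zero hdiag hanti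
    (by simp [Matrix.fromBlocks_multiply, hAC, hGC]) (hsum ▸ hM')
  rw [inertiaPos_congr hsum _ hM', inertiaNeg_congr hsum _ hM',
    (inertia_fromBlocks_diag hA hGh.neg hdiag).1, (inertia_fromBlocks_diag hA hGh.neg hdiag).2,
    (inertia_fromBlocks_antidiag C hanti).1, (inertia_fromBlocks_antidiag C hanti).2,
    ← inertiaNeg_eq_inertiaPos_neg hGh] at hadd
  have hneg : inertiaNeg hGh.neg = inertiaPos hGh := by
    rw [inertiaNeg_eq_inertiaPos_neg hGh.neg hGh.neg.neg]
    exact inertiaPos_congr (neg_neg G) _ _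
  set T : Matrix (m ⊕ n) (m ⊕ n) ℂ := Matrix.fromBlocks 1 W 0 1 with hT
  set S : Matrix (m ⊕ n) (m ⊕ n) ℂ := Matrix.fromBlocks 1 (-W) 0 1 with hS
  have hTS : T * S = 1 := by simp [hT, hS, Matrix.fromBlocks_multiply]
  have hcon : Matrix.fromBlocks A C Cᴴ (-G) = Tᴴ * matM A B * T := by
    have h1' : Wᴴ * A + Bᴴ = Cᴴ := by
      rw [← h1, Matrix.conjTranspose_add, Matrix.conjTranspose_mul, hA.eq]
    rw [hT, matM, Matrix.fromBlocks_conjTranspose, Matrix.fromBlocks_multiply,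
      Matrix.fromBlocks_multiply]
    simp only [Matrix.conjTranspose_one, Matrix.conjTranspose_zero, Matrix.one_mul, Matrix.mul_one,
      Matrix.zero_mul, Matrix.mul_zero, add_zero, h1, h1']
    rw [← h2, Matrix.mul_add, ← h1', Matrix.add_mul, ← Matrix.mul_assoc]
    congr 1
    abel
  have hcon' : matM A B = Sᴴ * Matrix.fromBlocks A C Cᴴ (-G) * S := by
    rw [hcon]
    calc matM A B = (T * S)ᴴ * matM A B * (T * S) := by simp [hTS]
      _ = _ := by rw [Matrix.conjTranspose_mul]; simp only [Matrix.mul_assoc]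
  have hp := le_antisymm (inertiaPos_le_of_eq_compression hM' (matM_isHermitian hA B) S hcon')
    (inertiaPos_le_of_eq_compression (matM_isHermitian hA B) hM' T hcon)
  have hn := le_antisymm (inertiaNeg_le_of_eq_compression hM' (matM_isHermitian hA B) S hcon')
    (inertiaNeg_le_of_eq_compression (matM_isHermitian hA B) hM' T hcon)
  have hr : _ = _ + C.rank := rank_fromCols_eq hA B
  omega

end Bordered

/-! ### Elements of `S₁` -/

theorem isHermitian_mul_pinv_mul {m p : Type*} [Fintype m] [Fintype p]
    {K : Matrix m m ℂ} (hK : K.IsHermitian) (Q : Matrix m p ℂ) :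
    (Q * pinv (Qᴴ * K * Q) * Qᴴ).IsHermitian :=
  Matrix.isHermitian_mul_mul_conjTranspose _
    (isHermitian_pinv (Matrix.isHermitian_conjTranspose_mul_mul _ hK))

theorem mul_pinv_mul_mul_self {m p : Type*} [Fintype m] [Fintype p]
    (K : Matrix m m ℂ) (Q : Matrix m p ℂ) :
    (Q * pinv (Qᴴ * K * Q) * Qᴴ) * K * (Q * pinv (Qᴴ * K * Q) * Qᴴ)
      = Q * pinv (Qᴴ * K * Q) * Qᴴ := by
  calc _ = Q * (pinv (Qᴴ * K * Q) * (Qᴴ * K * Q) * pinv (Qᴴ * K * Q)) * Qᴴ := by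
        simp only [Matrix.mul_assoc]
    _ = _ := by rw [pinv_mul_self_mul_pinv]

section Shorted

theorem mul_hatI {m n : Type*} [Fintype n] [DecidableEq n] (B : Matrix m n ℂ) :
    B * hatI m n = hatB B := by
  rw [hatI, hatB, Matrix.mul_fromCols, Matrix.mul_one, Matrix.mul_zero]

variable {m n : Type*} [Fintype m] [Fintype n] [DecidableEq m] [DecidableEq n]

/-- The matrix `B̂ F_H`, whose range is `R(A) ∩ R(B)`. -/
noncomputable def rangeMeet (A : Matrix m m ℂ) (B : Matrix m n ℂ) : Matrix m (n ⊕ m) ℂ :=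
  hatB B * projF (matH A B)

theorem exists_rangeMeet_eq_mul (A : Matrix m m ℂ) (B : Matrix m n ℂ) :
    ∃ Y : Matrix m (n ⊕ m) ℂ, rangeMeet A B = A * Y := by
  refine ⟨Matrix.fromCols (0 : Matrix m n ℂ) (1 : Matrix m m ℂ) * projF (matH A B), ?_⟩
  have h := mul_projF (matH A B)
  have e : matH A B = hatB B - A * Matrix.fromCols (0 : Matrix m n ℂ) (1 : Matrix m m ℂ) := by
    rw [matH, hatB]
    ext i (j | j) <;> simp [Matrix.mul_fromCols]
  nth_rewrite 1 [e] at h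
  rw [Matrix.sub_mul, sub_eq_zero] at h
  rw [rangeMeet, h, Matrix.mul_assoc]

theorem exists_eq_rangeMeet_mul {p : Type*} (A : Matrix m m ℂ) (B : Matrix m n ℂ)
    (Y : Matrix n p ℂ) (Y' : Matrix m p ℂ) (h : B * Y = A * Y') :
    B * Y = rangeMeet A B * Matrix.fromRows Y Y' := by
  have h0 : matH A B * Matrix.fromRows Y Y' = 0 := by
    rw [matH, Matrix.fromCols_mul_fromRows, h, Matrix.neg_mul, add_neg_cancel]
  rw [rangeMeet, Matrix.mul_assoc, projF_mul_of_mul_eq_zero h0, hatB,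
    Matrix.fromCols_mul_fromRows, Matrix.zero_mul, add_zero]

theorem mem_minusSet_iff {A : Matrix m m ℂ} (hA : A.IsHermitian) (B : Matrix m n ℂ)
    (Z : Matrix m m ℂ) :
    Z ∈ minusSet A B ↔
      Z.IsHermitian ∧ Z * pinv A * Z = Z ∧ ∃ T : Matrix (n ⊕ m) m ℂ, Z = rangeMeet A B * T := by
  constructor
  · rintro ⟨hZ, hle, hr⟩
    obtain ⟨h1, h2⟩ := (minusLE_iff hZ hA).mp hle
    obtain ⟨Y, hY⟩ := exists_eq_mul_of_range_le hr
    refine ⟨hZ, h2, _, hY.trans (exists_eq_rangeMeet_mul A B Y (pinv A * Z) ?_)⟩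
    rw [← hY, ← Matrix.mul_assoc, h1]
  · rintro ⟨hZ, h2, T, hT⟩
    obtain ⟨Y, hY⟩ := exists_rangeMeet_eq_mul A B
    refine ⟨hZ, (minusLE_iff hZ hA).mpr ⟨?_, h2⟩, ?_⟩
    · rw [hT, hY, ← Matrix.mul_assoc, ← Matrix.mul_assoc, mul_pinv_mul_self]
    · rw [hT, rangeMeet, ← mul_hatI, Matrix.mul_assoc, Matrix.mul_assoc]
      exact range_mul_le _ _

/-- Every element of `S₁` is `Q (Q* A† Q)† Q*` with `Q = B̂ F_H U`. For the direct implication `U` is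
chosen with `Q = [0, Z]`, so that `Q* A† Q` is `0 ⊕ Z`. -/
theorem mem_minusSet_iff_exists {A : Matrix m m ℂ} (hA : A.IsHermitian) (B : Matrix m n ℂ)
    (Z : Matrix m m ℂ) :
    Z ∈ minusSet A B ↔ ∃ U : Matrix (n ⊕ m) (n ⊕ m) ℂ,
      Z = rangeMeet A B * U
        * pinv ((rangeMeet A B * U)ᴴ * pinv A * (rangeMeet A B * U)) * (rangeMeet A B * U)ᴴ := by
  rw [mem_minusSet_iff hA]
  constructor
  · rintro ⟨hZ, h2, T, hT⟩
    set R : Matrix m (n ⊕ m) ℂ := Matrix.fromCols 0 1 with hR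
    have hRR : R * Rᴴ = 1 := by
      rw [hR, Matrix.conjTranspose_fromCols_eq_fromRows_conjTranspose,
        Matrix.fromCols_mul_fromRows]
      simp
    have hcol : ∀ X Y : Matrix m m ℂ, (Rᴴ * X * R) * (Rᴴ * Y * R) = Rᴴ * (X * Y) * R := by
      intro X Y
      calc _ = Rᴴ * X * (R * Rᴴ) * Y * R := by simp only [Matrix.mul_assoc]
        _ = _ := by rw [hRR, Matrix.mul_one, Matrix.mul_assoc Rᴴ]
    have hp := isMoorePenrose_pinv Z
    have hpinv : pinv (Rᴴ * Z * R) = Rᴴ * pinv Z * R := by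
      refine pinv_eq ⟨?_, ?_, ?_, ?_⟩
      · rw [hcol, hcol, hp.mul_mul_self]
      · rw [hcol, hcol, hp.self_mul_mul]
      · rw [hcol]; exact Matrix.isHermitian_conjTranspose_mul_mul _ hp.isHermitian_left
      · rw [hcol]; exact Matrix.isHermitian_conjTranspose_mul_mul _ hp.isHermitian_right
    refine ⟨T * R, ?_⟩
    rw [← Matrix.mul_assoc, ← hT, Matrix.conjTranspose_mul, hZ.eq]
    have e : Rᴴ * Z * pinv A * (Z * R) = Rᴴ * Z * R := by
      calc _ = Rᴴ * (Z * pinv A * Z) * R := by simp only [Matrix.mul_assoc]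
        _ = _ := by rw [h2]
    rw [e, hpinv]
    calc Z = Z * (R * Rᴴ) * pinv Z * (R * Rᴴ) * Z := by
          rw [hRR, Matrix.mul_one, Matrix.mul_one, mul_pinv_mul_self]
      _ = _ := by simp only [Matrix.mul_assoc]
  · rintro ⟨U, hU⟩
    have hK := isHermitian_pinv hA
    refine ⟨hU ▸ isHermitian_mul_pinv_mul hK _, ?_, ?_⟩
    · rw [hU]; exact mul_pinv_mul_mul_self _ _
    · rw [hU]; simp only [Matrix.mul_assoc]; exact ⟨_, rfl⟩

/-- The shorted matrix `φ⁻(A | B)`. -/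
noncomputable def minusShorted (A : Matrix m m ℂ) (B : Matrix m n ℂ) : Matrix m m ℂ :=
  rangeMeet A B * pinv ((rangeMeet A B)ᴴ * pinv A * rangeMeet A B) * (rangeMeet A B)ᴴ

theorem minusShorted_mem {A : Matrix m m ℂ} (hA : A.IsHermitian) (B : Matrix m n ℂ) :
    minusShorted A B ∈ minusSet A B :=
  (mem_minusSet_iff_exists hA B _).mpr ⟨1, by rw [Matrix.mul_one]; rfl⟩

/-- The form `A†` restricted to `R(A) ∩ R(B)`, in terms of `rangeMeet`, has the inertia of
`residualForm`: `rangeMeet A B` and `B F_C`, with `C = residualMatrix A B`, have the same range. -/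
theorem inertia_residualForm {A : Matrix m m ℂ} (hA : A.IsHermitian) (B : Matrix m n ℂ)
    (hG : ((rangeMeet A B)ᴴ * pinv A * rangeMeet A B).IsHermitian) :
    inertiaPos (isHermitian_residualForm hA B) = inertiaPos hG ∧
      inertiaNeg (isHermitian_residualForm hA B) = inertiaNeg hG := by
  set C := residualMatrix A B with hC
  have h1 : ∃ T : Matrix (n ⊕ m) n ℂ, B * projF C = rangeMeet A B * T := by
    refine ⟨_, exists_eq_rangeMeet_mul A B _ (pinv A * B * projF C) ?_⟩
    have := mul_projF C
    nth_rewrite 1 [hC] at this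
    rw [residualMatrix, Matrix.sub_mul, sub_eq_zero] at this
    rw [this, Matrix.mul_assoc, ← Matrix.mul_assoc]
  have h2 : ∃ T : Matrix n (n ⊕ m) ℂ, rangeMeet A B = B * projF C * T := by
    obtain ⟨Y, hY⟩ := exists_rangeMeet_eq_mul A B
    have hB : rangeMeet A B = B * (hatI m n * projF (matH A B)) := by
      rw [rangeMeet, ← mul_hatI, Matrix.mul_assoc]
    refine ⟨hatI m n * projF (matH A B), ?_⟩
    rw [Matrix.mul_assoc, projF_mul_of_mul_eq_zero, ← hB]
    rw [hC, residualMatrix, Matrix.sub_mul, Matrix.mul_assoc A, Matrix.mul_assoc (pinv A), ← hB,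
      hY, ← Matrix.mul_assoc, ← Matrix.mul_assoc, mul_pinv_mul_self, sub_self]
  obtain ⟨T, hT⟩ := h1
  obtain ⟨S, hS⟩ := h2
  have e0 : residualForm A B = (B * projF C)ᴴ * pinv A * (B * projF C) := by
    rw [residualForm, Matrix.conjTranspose_mul, (isHermitian_projF C).eq]
    simp only [Matrix.mul_assoc, hC]
  have e1 : residualForm A B = Tᴴ * ((rangeMeet A B)ᴴ * pinv A * rangeMeet A B) * T := by
    rw [e0, hT, Matrix.conjTranspose_mul]; simp only [Matrix.mul_assoc]
  have e2 : (rangeMeet A B)ᴴ * pinv A * rangeMeet A B = Sᴴ * residualForm A B * S := by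
    rw [e0]
    conv_lhs => rw [hS]
    rw [Matrix.conjTranspose_mul _ S]; simp only [Matrix.mul_assoc]
  exact ⟨le_antisymm (inertiaPos_le_of_eq_compression hG _ T e1)
      (inertiaPos_le_of_eq_compression _ hG S e2),
    le_antisymm (inertiaNeg_le_of_eq_compression hG _ T e1)
      (inertiaNeg_le_of_eq_compression _ hG S e2)⟩

/-- Elements of `S₁` are compressions of `G = (B̂ F_H)* A† (B̂ F_H)`. -/
theorem eq_compression_of_mem_minusSet {A : Matrix m m ℂ} (hA : A.IsHermitian)
    (B : Matrix m n ℂ) {Z : Matrix m m ℂ} (hZ : Z ∈ minusSet A B) :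
    ∃ T : Matrix (n ⊕ m) m ℂ, Z = Tᴴ * ((rangeMeet A B)ᴴ * pinv A * rangeMeet A B) * T := by
  obtain ⟨h1, h2, T, hT⟩ := (mem_minusSet_iff hA B Z).mp hZ
  refine ⟨T, ?_⟩
  calc Z = Zᴴ * pinv A * Z := by rw [h1.eq, h2]
    _ = _ := by rw [hT, Matrix.conjTranspose_mul]; simp only [Matrix.mul_assoc]

theorem eq_compression_minusShorted {A : Matrix m m ℂ} (hA : A.IsHermitian)
    (B : Matrix m n ℂ) :
    (rangeMeet A B)ᴴ * pinv A * rangeMeet A B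
      = (pinv A * rangeMeet A B)ᴴ * minusShorted A B * (pinv A * rangeMeet A B) := by
  rw [Matrix.conjTranspose_mul, (isHermitian_pinv hA).eq, minusShorted]
  set G := (rangeMeet A B)ᴴ * pinv A * rangeMeet A B with hG
  calc G = G * pinv G * G := (mul_pinv_mul_self G).symm
    _ = _ := by
      nth_rewrite 1 3 [hG]
      simp only [Matrix.mul_assoc]

theorem inertia_le_minusShorted {A : Matrix m m ℂ} (hA : A.IsHermitian) (B : Matrix m n ℂ)
    {Z : Matrix m m ℂ} (hZ : Z ∈ minusSet A B) :
    inertiaPos hZ.1 ≤ inertiaPos (minusShorted_mem hA B).1 ∧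
      inertiaNeg hZ.1 ≤ inertiaNeg (minusShorted_mem hA B).1 := by
  have hG := Matrix.isHermitian_conjTranspose_mul_mul (rangeMeet A B) (isHermitian_pinv hA)
  obtain ⟨T, hT⟩ := eq_compression_of_mem_minusSet hA B hZ
  have e := eq_compression_minusShorted hA B
  exact ⟨(inertiaPos_le_of_eq_compression hG _ T hT).trans
      (inertiaPos_le_of_eq_compression _ hG _ e),
    (inertiaNeg_le_of_eq_compression hG _ T hT).trans
      (inertiaNeg_le_of_eq_compression _ hG _ e)⟩

theorem inertia_minusShorted {A : Matrix m m ℂ} (hA : A.IsHermitian) (B : Matrix m n ℂ) :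
    inertiaPos (minusShorted_mem hA B).1 + (Matrix.fromCols A B).rank
        = inertiaNeg (matM_isHermitian hA B) + inertiaPos hA ∧
      inertiaNeg (minusShorted_mem hA B).1 + (Matrix.fromCols A B).rank
        = inertiaPos (matM_isHermitian hA B) + inertiaNeg hA := by
  have hG := Matrix.isHermitian_conjTranspose_mul_mul (rangeMeet A B) (isHermitian_pinv hA)
  obtain ⟨T, hT⟩ := eq_compression_of_mem_minusSet hA B (minusShorted_mem hA B)
  have e := eq_compression_minusShorted hA B
  have hp := le_antisymm
    (inertiaPos_le_of_eq_compression hG (minusShorted_mem hA B).1 T hT)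
    (inertiaPos_le_of_eq_compression _ hG _ e)
  have hn := le_antisymm
    (inertiaNeg_le_of_eq_compression hG (minusShorted_mem hA B).1 T hT)
    (inertiaNeg_le_of_eq_compression _ hG _ e)
  have h1 := inertia_residualForm hA B hG
  have h2 := inertia_matM hA B
  have h3 := rank_eq_inertiaPos_add_inertiaNeg hA
  omega

/-- Inertia is subadditive, so additivity of rank forces additivity of both inertias. -/
theorem inertia_sub_of_minusLE {A Z : Matrix m m ℂ} (hA : A.IsHermitian) (hZ : Z.IsHermitian)
    (h : MinusLE Z A) :
    inertiaPos (hA.sub hZ) + inertiaPos hZ = inertiaPos hA ∧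
      inertiaNeg (hA.sub hZ) + inertiaNeg hZ = inertiaNeg hA := by
  have hD : (Matrix.fromBlocks (A - Z) 0 0 Z).IsHermitian :=
    (hA.sub hZ).fromBlocks (by simp) hZ
  have hd := inertia_fromBlocks_diag (hA.sub hZ) hZ hD
  have e : A = (Matrix.fromRows (1 : Matrix m m ℂ) (1 : Matrix m m ℂ))ᴴ
      * Matrix.fromBlocks (A - Z) 0 0 Z
      * Matrix.fromRows (1 : Matrix m m ℂ) (1 : Matrix m m ℂ) := by
    rw [Matrix.conjTranspose_fromRows_eq_fromCols_conjTranspose]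
    simp [Matrix.fromCols_mul_fromBlocks, Matrix.fromCols_mul_fromRows]
  have hp := inertiaPos_le_of_eq_compression hD hA _ e
  have hn := inertiaNeg_le_of_eq_compression hD hA _ e
  rw [MinusLE, rank_eq_inertiaPos_add_inertiaNeg hA, rank_eq_inertiaPos_add_inertiaNeg hZ,
    rank_eq_inertiaPos_add_inertiaNeg (hA.sub hZ)] at h
  omega

/-- The Hermitian solutions of `B X B* ≤⁻ A`: `B X B*` must be an element of `S₁`, and the Hermitian
solutions of `B Y B* = 0` are the matrices `V - B† B V B† B`. -/
theorem minusLE_conj_iff_exists {A : Matrix m m ℂ} (hA : A.IsHermitian) (B : Matrix m n ℂ)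
    (X : Matrix n n ℂ) :
    (X.IsHermitian ∧ MinusLE (B * X * Bᴴ) A) ↔
      ∃ (U : Matrix (n ⊕ m) (n ⊕ m) ℂ) (V : Matrix n n ℂ), V.IsHermitian ∧
        X = hatI m n * projF (matH A B) * U
            * pinv ((rangeMeet A B * U)ᴴ * pinv A * (rangeMeet A B * U))
            * (hatI m n * projF (matH A B) * U)ᴴ
          + V - pinv B * B * V * pinv B * B := by
  have hB : pinv B * B * Bᴴ = Bᴴ := by
    have := congrArg Matrix.conjTranspose (mul_pinv_mul_self B)
    rwa [Matrix.mul_assoc, Matrix.conjTranspose_mul,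
      (isMoorePenrose_pinv B).isHermitian_right.eq] at this
  have hBP : ∀ U : Matrix (n ⊕ m) (n ⊕ m) ℂ,
      B * (hatI m n * projF (matH A B) * U) = rangeMeet A B * U := by
    intro U
    rw [rangeMeet, ← mul_hatI]; simp only [Matrix.mul_assoc]
  have hX0 : ∀ U : Matrix (n ⊕ m) (n ⊕ m) ℂ, ∀ N : Matrix (n ⊕ m) (n ⊕ m) ℂ,
      B * (hatI m n * projF (matH A B) * U * N * (hatI m n * projF (matH A B) * U)ᴴ) * Bᴴ
        = rangeMeet A B * U * N * (rangeMeet A B * U)ᴴ := by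
    intro U N
    rw [← hBP, Matrix.conjTranspose_mul B]
    simp only [Matrix.mul_assoc]
  have hN : ∀ U : Matrix (n ⊕ m) (n ⊕ m) ℂ,
      (pinv ((rangeMeet A B * U)ᴴ * pinv A * (rangeMeet A B * U))).IsHermitian := fun U =>
    isHermitian_pinv (Matrix.isHermitian_conjTranspose_mul_mul _ (isHermitian_pinv hA))
  constructor
  · rintro ⟨hX, hle⟩
    have hmem : B * X * Bᴴ ∈ minusSet A B :=
      ⟨Matrix.isHermitian_mul_mul_conjTranspose B hX, hle, by
        rw [Matrix.mul_assoc]; exact range_mul_le _ _⟩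
    obtain ⟨U, hU⟩ := (mem_minusSet_iff_exists hA B _).mp hmem
    rw [← hX0] at hU
    set X0 := hatI m n * projF (matH A B) * U
      * pinv ((rangeMeet A B * U)ᴴ * pinv A * (rangeMeet A B * U))
      * (hatI m n * projF (matH A B) * U)ᴴ with hX0'
    have hX0h : X0.IsHermitian := Matrix.isHermitian_mul_mul_conjTranspose _ (hN U)
    refine ⟨U, X - X0, hX.sub hX0h, ?_⟩
    have h0 : pinv B * B * (X - X0) * pinv B * B = 0 := by
      have hadj : pinv B * B = Bᴴ * (pinv B)ᴴ := by
        rw [← Matrix.conjTranspose_mul, (isMoorePenrose_pinv B).isHermitian_right.eq]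
      calc pinv B * B * (X - X0) * pinv B * B
          = pinv B * (B * (X - X0)) * (pinv B * B) := by simp only [Matrix.mul_assoc]
        _ = pinv B * (B * X * Bᴴ - B * X0 * Bᴴ) * (pinv B)ᴴ := by
          rw [hadj, Matrix.mul_sub, ← Matrix.sub_mul]; simp only [Matrix.mul_assoc]
        _ = 0 := by rw [hU, sub_self, Matrix.mul_zero, Matrix.zero_mul]
    rw [h0]
    abel
  · rintro ⟨U, V, hV, rfl⟩
    have hQ : (pinv B * B)ᴴ = pinv B * B := (isMoorePenrose_pinv B).isHermitian_right.eq
    refine ⟨((Matrix.isHermitian_mul_mul_conjTranspose _ (hN U)).add hV).sub ?_, ?_⟩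
    · have := Matrix.isHermitian_mul_mul_conjTranspose (pinv B * B) hV
      rwa [hQ, ← Matrix.mul_assoc] at this
    · have h0 : B * (pinv B * B * V * pinv B * B) * Bᴴ = B * V * Bᴴ := by
        calc _ = B * pinv B * B * V * (pinv B * B * Bᴴ) := by simp only [Matrix.mul_assoc]
          _ = _ := by rw [mul_pinv_mul_self, hB]
      rw [Matrix.mul_sub, Matrix.sub_mul, h0, Matrix.mul_add, Matrix.add_mul, hX0,
        add_sub_cancel_right]
      exact ((mem_minusSet_iff_exists hA B _).mpr ⟨U, rfl⟩).2.1

end Shorted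

/-! ### Parametrization and extremal values -/

theorem theorem3p2 (m n : ℕ) (A : Matrix (Fin m) (Fin m) ℂ) (hA : A.IsHermitian)
    (B : Matrix (Fin m) (Fin n) ℂ) :
    -- (a) the general Hermitian solution of `B X B* ≤⁻ A`
    (∀ X : Matrix (Fin n) (Fin n) ℂ,
      (X.IsHermitian ∧ MinusLE (B * X * Bᴴ) A) ↔
        ∃ (U : Matrix (Fin n ⊕ Fin m) (Fin n ⊕ Fin m) ℂ) (V : Matrix (Fin n) (Fin n) ℂ),
          V.IsHermitian ∧
          X = hatI (Fin m) (Fin n) * projF (matH A B) * U *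
                pinv (Uᴴ * projF (matH A B) * (hatB B)ᴴ * pinv A * hatB B *
                  projF (matH A B) * U) *
                Uᴴ * projF (matH A B) * (hatI (Fin m) (Fin n))ᴴ
              + V - pinv B * B * V * pinv B * B) ∧
    -- (b) the general element of `S₁`
    (∀ Z : Matrix (Fin m) (Fin m) ℂ,
      Z ∈ minusSet A B ↔
        ∃ U : Matrix (Fin n ⊕ Fin m) (Fin n ⊕ Fin m) ℂ,
          Z = hatB B * projF (matH A B) * U *
                pinv (Uᴴ * projF (matH A B) * (hatB B)ᴴ * pinv A * hatB B *
                  projF (matH A B) * U) *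
                Uᴴ * projF (matH A B) * (hatB B)ᴴ) ∧
    -- maximal inertia of `Z`
    IsGreatest {k : ℤ | ∃ (Z : Matrix (Fin m) (Fin m) ℂ) (hZ : Z ∈ minusSet A B),
        k = inertiaPos hZ.1}
      ((inertiaNeg (matM_isHermitian hA B) : ℤ) + inertiaPos hA
        - (Matrix.fromCols A B).rank) ∧
    IsGreatest {k : ℤ | ∃ (Z : Matrix (Fin m) (Fin m) ℂ) (hZ : Z ∈ minusSet A B),
        k = inertiaNeg hZ.1}
      ((inertiaPos (matM_isHermitian hA B) : ℤ) + inertiaNeg hA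
        - (Matrix.fromCols A B).rank) ∧
    -- maximal rank of `Z`
    IsGreatest {k : ℤ | ∃ Z ∈ minusSet A B, k = Z.rank}
      (((matM A B).rank : ℤ) + A.rank - 2 * (Matrix.fromCols A B).rank) ∧
    -- minimal inertia of `A - Z`
    IsLeast {k : ℤ | ∃ (Z : Matrix (Fin m) (Fin m) ℂ) (hZ : Z ∈ minusSet A B),
        k = inertiaPos (hA.sub hZ.1)}
      (((Matrix.fromCols A B).rank : ℤ) - inertiaNeg (matM_isHermitian hA B)) ∧
    IsLeast {k : ℤ | ∃ (Z : Matrix (Fin m) (Fin m) ℂ) (hZ : Z ∈ minusSet A B),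
        k = inertiaNeg (hA.sub hZ.1)}
      (((Matrix.fromCols A B).rank : ℤ) - inertiaPos (matM_isHermitian hA B)) ∧
    -- minimal rank of `A - Z`
    IsLeast {k : ℤ | ∃ Z ∈ minusSet A B, k = (A - Z).rank}
      (2 * ((Matrix.fromCols A B).rank : ℤ) - (matM A B).rank) ∧
    -- the closed form of a shorted matrix
    IsMinusShorted A B
      (hatB B * projF (matH A B) *
        pinv (projF (matH A B) * (hatB B)ᴴ * pinv A * hatB B * projF (matH A B)) *
        projF (matH A B) * (hatB B)ᴴ) := by
  have hF := (isHermitian_projF (matH A B)).eq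
  have hP : (rangeMeet A B)ᴴ = projF (matH A B) * (hatB B)ᴴ := by
    rw [rangeMeet, Matrix.conjTranspose_mul, hF]
  have hφ : hatB B * projF (matH A B) *
      pinv (projF (matH A B) * (hatB B)ᴴ * pinv A * hatB B * projF (matH A B)) *
      projF (matH A B) * (hatB B)ᴴ = minusShorted A B := by
    rw [minusShorted, hP, rangeMeet]
    simp only [Matrix.mul_assoc]
  have hmem := minusShorted_mem hA B
  have hle := fun {Z : Matrix (Fin m) (Fin m) ℂ} (hZ : Z ∈ minusSet A B) =>
    inertia_le_minusShorted hA B hZ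
  have hφi := inertia_minusShorted hA B
  have hsub := fun {Z : Matrix (Fin m) (Fin m) ℂ} (hZ : Z ∈ minusSet A B) =>
    inertia_sub_of_minusLE hA hZ.1 hZ.2.1
  have hrZ := fun {Z : Matrix (Fin m) (Fin m) ℂ} (hZ : Z ∈ minusSet A B) =>
    rank_eq_inertiaPos_add_inertiaNeg hZ.1
  have hrS := fun {Z : Matrix (Fin m) (Fin m) ℂ} (hZ : Z ∈ minusSet A B) =>
    rank_eq_inertiaPos_add_inertiaNeg (hA.sub hZ.1)
  have hrA := rank_eq_inertiaPos_add_inertiaNeg hA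
  have hrM := rank_eq_inertiaPos_add_inertiaNeg (matM_isHermitian hA B)
  have hsφ := hsub hmem
  have hrφ := hrZ hmem
  have hrSφ := hrS hmem
  refine ⟨fun X => ?_, fun Z => ?_, ⟨⟨_, hmem, by omega⟩, ?_⟩, ⟨⟨_, hmem, by omega⟩, ?_⟩,
    ⟨⟨_, hmem, by omega⟩, ?_⟩, ⟨⟨_, hmem, by omega⟩, ?_⟩, ⟨⟨_, hmem, by omega⟩, ?_⟩,
    ⟨⟨_, hmem, by omega⟩, ?_⟩, ?_⟩
  · rw [minusLE_conj_iff_exists hA B X]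
    simp only [Matrix.conjTranspose_mul, hF, Matrix.mul_assoc, rangeMeet]
  · rw [mem_minusSet_iff_exists hA B Z]
    simp only [Matrix.conjTranspose_mul, hF, Matrix.mul_assoc, rangeMeet]
  · rintro _ ⟨Z, hZ, rfl⟩
    have := hle hZ
    omega
  · rintro _ ⟨Z, hZ, rfl⟩
    have := hle hZ
    omega
  · rintro _ ⟨Z, hZ, rfl⟩
    have := hle hZ
    have := hrZ hZ
    omega
  · rintro _ ⟨Z, hZ, rfl⟩
    have := hle hZ
    have := hsub hZ
    omega
  · rintro _ ⟨Z, hZ, rfl⟩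
    have := hle hZ
    have := hsub hZ
    omega
  · rintro _ ⟨Z, hZ, rfl⟩
    have := hle hZ
    have := hsub hZ
    have := hrS hZ
    omega
  · rw [hφ]
    refine ⟨hmem, fun Z hZ => ?_⟩
    have := hle hZ
    have := hrZ hZ
    omega
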